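/- Let $S=(S_t)_{t\ge 0}$ denote a positive Gamma process with $S_0=0$: increasing right-continuous paths, independent increments, and $S_t-S_s$ Gamma distributed with shape $t-s$ and rate $1$ for $s<t$. For locally integrable $h\ge 0$ on $[0,\infty)$ write $$\lambda_t h=\int_0^t h(x)\,dx,\qquad v_t(h)=\frac{\lambda_t (h^2)}{(\lambda_t h)^2},\qquad b_t(h)=\frac{h(t)}{\lambda_t h},\qquad R_t(h)=\frac{\int_0^t h\,dS}{\lambda_t h},$$ where $\int_0^t h\,dS$ is the pathwise Lebesgue-Stieltjes integral. For $0\le p<\infty$, $h$ satisfies orderly divergence in $L^p$ if $\lambda_t h\to\infty$ and $R_t(h)\to 1$ in $L^p$ as $t\to\infty$ (for $p=0$: in probability). Theorem. Let $g\ge 0$ be a measurable periodic function with $\operatorname{ess\,sup} g=1$. There is a constant $C>0$, depending only on $g$, such that the following holds for every increasing (i.e. nondecreasing) function $f:[0,\infty)\to[0,\infty)$ with $\lambda_t f\to\infty$ that satisfies one of the conditions: orderly divergence in probability; $v_t(f)\to 0$; $b_t(f)\to 0$. The product $fg$ is locally square integrable, $$v_t(fg)\le C\,v_t(f)\quad\text{for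 all sufficiently large } t,$$ and $fg$ satisfies orderly divergence in $L^p$ for every $0\le p<\infty$. -/

import Mathlib

open MeasureTheory ProbabilityTheory Filter Set
open scoped NNReal ENNReal Topology

universe u v

/-- A positive Gamma process on `[0, ∞)`: it starts at `0`, has increasing right-continuous paths
and independent increments, and the increment over `(s, t]` has the Gamma distribution with
shape `t - s` and rate `1`; in particular the value at time `1` is exponential with mean `1`. -/
structure GammaProcess {Ω : Type*} [MeasurableSpace Ω] (P : Measure Ω) where
  /-- the value of the process at a time, as a random variable -/
  toFun : ℝ≥0 → Ω → ℝ
  measurable_toFun : ∀ t, Measurable (toFun t)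
  map_zero : ∀ ω, toFun 0 ω = 0
  mono : ∀ ω, Monotone fun t => toFun t ω
  right_continuous : ∀ ω t, ContinuousWithinAt (fun u => toFun u ω) (Ici t) t
  indep : HasIndepIncrements toFun P
  law : ∀ s t : ℝ≥0, s < t →
    P.map (fun ω => toFun t ω - toFun s ω) = gammaMeasure ((t : ℝ) - (s : ℝ)) 1

namespace GammaProcess

variable {Ω : Type*} [MeasurableSpace Ω] {P : Measure Ω}

/-- A path of the process, extended by `0` to negative times. -/
def path (S : GammaProcess P) (ω : Ω) : StieltjesFunction ℝ where
  toFun x := S.toFun x.toNNReal ω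
  mono' _ _ h := S.mono ω (Real.toNNReal_mono h)
  right_continuous' x :=
    (S.right_continuous ω x.toNNReal).comp continuous_real_toNNReal.continuousWithinAt
      fun _ h => Real.toNNReal_mono h

/-- The pathwise Gamma integral `∫₀ᵗ f dS`: the integral of `f` over `(0, t]` with respect to the
Lebesgue-Stieltjes measure of the path (the path has no mass at `0`). -/
noncomputable def integral (S : GammaProcess P) (f : ℝ → ℝ) (t : ℝ) (ω : Ω) : ℝ :=
  ∫ x in Ioc 0 t, f x ∂(S.path ω).measure

end GammaProcess

/-- `λ_t f = ∫₀ᵗ f(x) dx`. -/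
noncomputable def cumul (f : ℝ → ℝ) (t : ℝ) : ℝ := ∫ x in (0 : ℝ)..t, f x

/-- `v_t(f) = λ_t(f²) / (λ_t f)²`. -/
noncomputable def vChar (f : ℝ → ℝ) (t : ℝ) : ℝ := cumul (fun x => f x ^ 2) t / cumul f t ^ 2

/-- `b_t(f) = f(t) / λ_t f`. -/
noncomputable def bChar (f : ℝ → ℝ) (t : ℝ) : ℝ := f t / cumul f t

/-- Convergence in `L^p`, `0 ≤ p < ∞`, as `t → ∞`, of real random variables `R t` to a constant `c`;
for `p = 0` this is convergence in probability. -/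
def ConvergesInLp {Ω : Type*} [MeasurableSpace Ω] (P : Measure Ω) (p : ℝ≥0) (R : ℝ → Ω → ℝ)
    (c : ℝ) : Prop :=
  (∀ᶠ t in atTop, MemLp (R t) (p : ℝ≥0∞) P) ∧
    if p = 0 then TendstoInMeasure P R atTop (fun _ => c)
    else Tendsto (fun t => eLpNorm (fun ω => R t ω - c) (p : ℝ≥0∞) P) atTop (𝓝 0)

/-- Orderly divergence of `f` in `L^p`: `f` is locally integrable on `[0, ∞)`, `λ_t f → ∞`, and
`R_t = (∫₀ᵗ f dS) / λ_t f` converges to `1` in `L^p`. -/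
def OrderlyDivergent {Ω : Type*} [MeasurableSpace Ω] {P : Measure Ω} (S : GammaProcess P)
    (p : ℝ≥0) (f : ℝ → ℝ) : Prop :=
  (∀ t, IntegrableOn f (Ioc 0 t)) ∧ Tendsto (cumul f) atTop atTop ∧
    ConvergesInLp P p (fun t ω => S.integral f t ω / cumul f t) 1

/-- The class OD: orderly divergence in probability. The property depends only on the law of the
process, so it does not matter which Gamma process is used. -/
def InClassOD (f : ℝ → ℝ) : Prop :=
  ∃ (Ω : Type u) (_ : MeasurableSpace Ω) (P : Measure Ω) (_ : IsProbabilityMeasure P)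
    (S : GammaProcess P), OrderlyDivergent S 0 f

/-- The class `V`: `f` is locally square integrable, `λ_t f → ∞` and `v_t(f) → 0`. -/
def InClassV (f : ℝ → ℝ) : Prop :=
  (∀ t, MemLp f 2 (volume.restrict (Ioc 0 t))) ∧ Tendsto (cumul f) atTop atTop ∧
    Tendsto (vChar f) atTop (𝓝 0)

/-- The class `B`: `f` is locally integrable, `λ_t f → ∞` and `b_t(f) → 0`. -/
def InClassB (f : ℝ → ℝ) : Prop :=
  (∀ t, IntegrableOn f (Ioc 0 t)) ∧ Tendsto (cumul f) atTop atTop ∧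
    Tendsto (bChar f) atTop (𝓝 0)

/-- The periodic factor of a regular quasi-periodic product: a measurable periodic function `g ≥ 0`
with essential supremum `1`. -/
structure IsRegularPeriodicFactor (g : ℝ → ℝ) : Prop where
  measurable : Measurable g
  nonneg : ∀ x, 0 ≤ g x
  periodic : ∃ T : ℝ, 0 < T ∧ Function.Periodic g T
  essSup_eq_one : essSup g volume = 1

/-! For monotone `F`, each of the three conditions implies `b_t(F) → 0`, and this alone gives the
conclusions.

If `v_t → 0`, Cauchy–Schwarz on `[t, t+1]` bounds the share of `λ_{t+1} F` carried by that interval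
by `√v_{t+1}`, and `F t` is at most the integral over it (`tendsto_bChar_of_tendsto_vChar`). If `R_t
→ 1` in probability, then `E exp(-R_t) → 1/e`; but `E exp(-R_t) = exp(-∫ log(1 + F/λ_t F))`, and a
last unit interval with share at least `δ` keeps this above `1/e` by a fixed factor, by strict
concavity of the logarithm (`tendsto_bChar_of_tendstoInMeasure`).

If `b_t → 0`, shifting by one period compares `λ_t(Fg)` with the mean of `g` times `λ_t F`, up to
two periods at the end that cost `O(F t)`. Hence `λ_t(Fg) ≥ c λ_t F` eventually, with `c` depending
only on `g` (`exists_cumul_mul_ge`), and the bound on `v_t` follows from `g ≤ 1` a.e.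

Finally `0 ≤ Fg ≤ F t` a.e. on `(0, t]` and `F t / λ_t(Fg) → 0`. The Laplace functional of the Gamma
integral then bounds every exponential moment of `R_t - 1`, so all its absolute moments tend to `0`
(`convergesInLp_ratio`). -/

namespace ProbabilityTheory

/-! ### Moments of the Gamma law. -/

theorem lintegral_rpow_mul_exp_neg_mul_Ioi {a r : ℝ} (ha : 0 < a) (hr : 0 < r) :
    ∫⁻ x in Ioi (0 : ℝ), ENNReal.ofReal (x ^ (a - 1) * Real.exp (-(r * x))) =
      ENNReal.ofReal ((1 / r) ^ a * Real.Gamma a) := by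
  have h := Real.integral_rpow_mul_exp_neg_mul_Ioi ha hr
  rw [← h, ofReal_integral_eq_lintegral_ofReal]
  -- A non-integrable function has integral `0` by default, so a nonzero value proves integrability.
  · refine .of_integral_ne_zero ?_
    rw [h]
    have := Real.Gamma_pos_of_pos ha
    positivity
  · filter_upwards [ae_restrict_mem measurableSet_Ioi] with x (hx : 0 < x)
    positivity

theorem lintegral_gammaMeasure_one (a : ℝ) {F : ℝ → ℝ≥0∞} (hF : Measurable F) :
    ∫⁻ x, F x ∂gammaMeasure a 1 = ∫⁻ x in Ioi (0 : ℝ),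
      ENNReal.ofReal (1 / Real.Gamma a * (x ^ (a - 1) * Real.exp (-x))) * F x := by
  have hm : Measurable (gammaPDF a 1) := (measurable_gammaPDFReal a 1).ennreal_ofReal
  rw [gammaMeasure, lintegral_withDensity_eq_lintegral_mul _ hm hF, ← lintegral_add_compl _ measurableSet_Ici,
    compl_Ici, setLIntegral_congr_fun (g := fun _ => 0) (s := Iio 0) measurableSet_Iio,
    lintegral_zero, add_zero, setLIntegral_congr Ioi_ae_eq_Ici.symm]
  · refine setLIntegral_congr_fun measurableSet_Ioi fun x (hx : 0 < x) => ?_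
    simp [gammaPDF_of_nonneg hx.le, mul_assoc]
  · intro x (hx : x < 0)
    simp [gammaPDF_of_neg hx]

theorem lintegral_exp_gammaMeasure {a c : ℝ} (ha : 0 < a) (hc : c < 1) :
    ∫⁻ x, ENNReal.ofReal (Real.exp (c * x)) ∂gammaMeasure a 1 =
      ENNReal.ofReal ((1 - c) ^ (-a)) := by
  have hG := Real.Gamma_pos_of_pos ha
  rw [lintegral_gammaMeasure_one a (by fun_prop)]
  have : ∀ x ∈ Ioi (0 : ℝ), ENNReal.ofReal (1 / Real.Gamma a * (x ^ (a - 1) * Real.exp (-x))) *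
      ENNReal.ofReal (Real.exp (c * x)) = ENNReal.ofReal (1 / Real.Gamma a) *
        ENNReal.ofReal (x ^ (a - 1) * Real.exp (-((1 - c) * x))) := by
    intro x (hx : 0 < x)
    rw [← ENNReal.ofReal_mul (by positivity), ← ENNReal.ofReal_mul (by positivity), mul_assoc,
      mul_assoc, ← Real.exp_add]
    congr 4
    ring_nf
  rw [setLIntegral_congr_fun measurableSet_Ioi this, lintegral_const_mul _ (by fun_prop),
    lintegral_rpow_mul_exp_neg_mul_Ioi ha (sub_pos.2 hc), ← ENNReal.ofReal_mul (by positivity)]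
  rw [Real.rpow_neg (by linarith), one_div (1 - c), Real.inv_rpow (by linarith)]
  congr 1
  field_simp

theorem lintegral_id_gammaMeasure {a : ℝ} (ha : 0 < a) :
    ∫⁻ x, ENNReal.ofReal x ∂gammaMeasure a 1 = ENNReal.ofReal a := by
  have hG := Real.Gamma_pos_of_pos ha
  rw [lintegral_gammaMeasure_one a (by fun_prop)]
  have : ∀ x ∈ Ioi (0 : ℝ), ENNReal.ofReal (1 / Real.Gamma a * (x ^ (a - 1) * Real.exp (-x))) *
      ENNReal.ofReal x = ENNReal.ofReal (1 / Real.Gamma a) *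
        ENNReal.ofReal (x ^ (a + 1 - 1) * Real.exp (-(1 * x))) := by
    intro x (hx : 0 < x)
    rw [← ENNReal.ofReal_mul (by positivity), ← ENNReal.ofReal_mul (by positivity),
      show a + 1 - 1 = (a - 1) + 1 by ring, Real.rpow_add_one hx.ne', one_mul]
    congr 1
    ring
  rw [setLIntegral_congr_fun measurableSet_Ioi this, lintegral_const_mul _ (by fun_prop),
    lintegral_rpow_mul_exp_neg_mul_Ioi (by linarith) one_pos, ← ENNReal.ofReal_mul (by positivity),
    Real.Gamma_add_one ha.ne']
  congr 1
  simp
  field_simp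

theorem mgf_id_gammaMeasure {a c : ℝ} (ha : 0 < a) (hc : c < 1) :
    mgf id (gammaMeasure a 1) c = (1 - c) ^ (-a) := by
  rw [mgf, integral_eq_lintegral_of_nonneg_ae (ae_of_all _ fun _ => (Real.exp_pos _).le)
    (by fun_prop)]
  simp only [id]
  rw [lintegral_exp_gammaMeasure ha hc, ENNReal.toReal_ofReal (Real.rpow_nonneg (by linarith) _)]

end ProbabilityTheory

/-! ### The random measure of a path: mean measure and step integrands. -/

namespace GammaProcess

variable {Ω : Type*} [MeasurableSpace Ω] {P : Measure Ω}

theorem measurable_path (S : GammaProcess P) (x : ℝ) : Measurable fun ω => S.path ω x :=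
  S.measurable_toFun x.toNNReal

theorem map_path_sub (S : GammaProcess P) {s t : ℝ} (hs : 0 ≤ s) (hst : s < t) :
    P.map (fun ω => S.path ω t - S.path ω s) = gammaMeasure (t - s) 1 := by
  have := S.law s.toNNReal t.toNNReal ((Real.toNNReal_lt_toNNReal_iff (hs.trans_lt hst)).2 hst)
  rwa [Real.coe_toNNReal _ hs, Real.coe_toNNReal _ (hs.trans hst.le)] at this

/-- The Lebesgue-Stieltjes measure of a path, restricted to `(0, T]`. -/
noncomputable def jumpMeasure (S : GammaProcess P) (T : ℝ) (ω : Ω) : Measure ℝ :=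
  (S.path ω).measure.restrict (Ioc 0 T)

instance (S : GammaProcess P) (T : ℝ) (ω : Ω) : IsFiniteMeasure (S.jumpMeasure T ω) :=
  ⟨by simp [jumpMeasure]⟩

theorem integral_eq (S : GammaProcess P) (f : ℝ → ℝ) (T : ℝ) (ω : Ω) :
    S.integral f T ω = ∫ x, f x ∂S.jumpMeasure T ω := rfl

theorem jumpMeasure_Ioc (S : GammaProcess P) (T a b : ℝ) (ω : Ω) :
    S.jumpMeasure T ω (Ioc a b) =
      ENNReal.ofReal (S.path ω (min b T) - S.path ω (max a 0)) := by
  rw [jumpMeasure, Measure.restrict_apply measurableSet_Ioc, Ioc_inter_Ioc,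
    StieltjesFunction.measure_Ioc]

theorem measurable_jumpMeasure (S : GammaProcess P) (T : ℝ) : Measurable (S.jumpMeasure T) := by
  refine Measurable.measure_of_isPiSystem
    ((borel_eq_generateFrom_Ioc ℝ ▸ BorelSpace.measurable_eq :
      _ = MeasurableSpace.generateFrom {S : Set ℝ | ∃ l u, l < u ∧ Ioc l u = S}))
    (isPiSystem_Ioc id id) ?_ ?_
  · rintro _ ⟨l, u, -, rfl⟩
    simp only [jumpMeasure_Ioc]
    exact ((S.measurable_path _).sub (S.measurable_path _)).ennreal_ofReal
  · simp only [jumpMeasure, Measure.restrict_apply_univ, StieltjesFunction.measure_Ioc]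
    exact ((S.measurable_path _).sub (S.measurable_path _)).ennreal_ofReal

/-- Campbell's formula: an increment has mean equal to its shape parameter, the interval length, so
the mean measure agrees with Lebesgue measure on intervals. -/
theorem bind_jumpMeasure (S : GammaProcess P) (T : ℝ) :
    P.bind (S.jumpMeasure T) = volume.restrict (Ioc 0 T) := by
  refine (Measure.ext_of_Ioc _ _ fun a b _ => ?_).symm
  rw [Measure.bind_apply measurableSet_Ioc (S.measurable_jumpMeasure T).aemeasurable,
    Measure.restrict_apply measurableSet_Ioc, Ioc_inter_Ioc, Real.volume_Ioc]
  simp only [jumpMeasure_Ioc]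
  rcases le_or_gt (min b T) (max a 0) with h | h
  · rw [ENNReal.ofReal_of_nonpos (sub_nonpos.2 h)]
    simp [ENNReal.ofReal_of_nonpos (sub_nonpos.2 ((S.path _).mono h))]
  · rw [← lintegral_id_gammaMeasure (sub_pos.2 h), ← S.map_path_sub (le_max_right _ _) h,
      lintegral_map ENNReal.measurable_ofReal
        (g := fun ω => S.path ω (min b T) - S.path ω (max a 0))
        ((S.measurable_path _).sub (S.measurable_path _))]

theorem lintegral_lintegral_jumpMeasure (S : GammaProcess P) (T : ℝ) {F : ℝ → ℝ≥0∞}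
    (hF : Measurable F) :
    ∫⁻ ω, ∫⁻ x, F x ∂S.jumpMeasure T ω ∂P = ∫⁻ x in Ioc 0 T, F x := by
  rw [← S.bind_jumpMeasure T, Measure.lintegral_bind (S.measurable_jumpMeasure T).aemeasurable
    hF.aemeasurable]

/-- Paths are pure jump, so their measures are not absolutely continuous; still, a fixed
Lebesgue-null set is almost surely not charged. Bounds such as `g ≤ 1`, known only a.e., can
therefore be used inside the pathwise integral. -/
theorem ae_ae_jumpMeasure (S : GammaProcess P) (T : ℝ) {p : ℝ → Prop}
    (hp : ∀ᵐ x ∂volume.restrict (Ioc 0 T), p x) : ∀ᵐ ω ∂P, ∀ᵐ x ∂S.jumpMeasure T ω, p x := by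
  rw [← S.bind_jumpMeasure T] at hp
  exact Measure.ae_ae_of_ae_bind (S.measurable_jumpMeasure T).aemeasurable hp

theorem measurable_integral (S : GammaProcess P) (T : ℝ) {h : ℝ → ℝ} (hh : Measurable h) :
    Measurable (S.integral h T) := by
  let κ : Kernel Ω ℝ := ⟨S.jumpMeasure T, S.measurable_jumpMeasure T⟩
  exact (hh.stronglyMeasurable.integral_kernel (κ := κ)).measurable

theorem mgf_path_sub (S : GammaProcess P) {s t c : ℝ} (hs : 0 ≤ s) (hst : s < t) (hc : c < 1) :
    mgf (fun ω => S.path ω t - S.path ω s) P c = (1 - c) ^ (-(t - s)) := by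
  rw [← mgf_id_gammaMeasure (sub_pos.2 hst) hc, ← S.map_path_sub hs hst, mgf_id_map]
  exact ((S.measurable_path _).sub (S.measurable_path _)).aemeasurable

/-- Independence turns the expectation into a product of Gamma moment generating functions. -/
theorem lintegral_exp_sum_path_sub (S : GammaProcess P) {τ : ℕ → ℝ} (hτ : StrictMono τ)
    (h0 : 0 ≤ τ 0) {c : ℕ → ℝ} (hc : ∀ i, c i < 1) (n : ℕ) :
    ∫⁻ ω, ENNReal.ofReal (Real.exp (∑ i ∈ Finset.range n,
      c i * (S.path ω (τ (i + 1)) - S.path ω (τ i)))) ∂P =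
    ENNReal.ofReal (Real.exp (∑ i ∈ Finset.range n,
      -Real.log (1 - c i) * (τ (i + 1) - τ i))) := by
  have hpos : ∀ i, 0 ≤ τ i := fun i => h0.trans (hτ.monotone (Nat.zero_le i))
  have hind : iIndepFun (fun i ω => S.path ω (τ (i + 1)) - S.path ω (τ i)) P :=
    S.indep.nat (t := fun i => (τ i).toNNReal) fun i j hij => Real.toNNReal_mono (hτ.monotone hij)
  have hind2 : iIndepFun (fun i ω => c i * (S.path ω (τ (i + 1)) - S.path ω (τ i))) P :=
    hind.comp (fun i x => c i * x) fun i => by fun_prop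
  have hmeas : ∀ i, Measurable fun ω => c i * (S.path ω (τ (i + 1)) - S.path ω (τ i)) := fun i =>
    ((S.measurable_path _).sub (S.measurable_path _)).const_mul _
  have hm := hind2.mgf_sum (t := 1) hmeas (Finset.range n)
  have hone : ∀ i, mgf (fun ω => c i * (S.path ω (τ (i + 1)) - S.path ω (τ i))) P 1 =
      Real.exp (-Real.log (1 - c i) * (τ (i + 1) - τ i)) := by
    intro i
    rw [mgf_const_mul, mul_one, S.mgf_path_sub (hpos i) (hτ (Nat.lt_succ_self i)) (hc i),
      Real.rpow_def_of_pos (by linarith [hc i])]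
    congr 1
    ring
  simp only [hone, ← Real.exp_sum] at hm
  rw [← hm, mgf, ofReal_integral_eq_lintegral_ofReal]
  · simp
  · refine .of_integral_ne_zero ?_
    rw [mgf] at hm
    rw [hm]
    positivity
  · exact ae_of_all _ fun _ => (Real.exp_pos _).le

end GammaProcess

/-! ### Approximation by step functions. -/

/-- The right endpoint of the cell containing `x` in the partition of `(0, T]` into `N` equal
cells. -/
noncomputable def rightEndpoint (T : ℝ) (N : ℕ) (x : ℝ) : ℝ := ⌈x / (T / N)⌉₊ * (T / N)

theorem measurable_rightEndpoint (T : ℝ) (N : ℕ) : Measurable (rightEndpoint T N) := by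
  unfold rightEndpoint
  have : Measurable fun x : ℝ => ⌈x / (T / N)⌉₊ := Nat.measurable_ceil.comp (by fun_prop)
  exact (measurable_from_top.comp this).mul_const _

theorem rightEndpoint_eq {T : ℝ} {N : ℕ} (hT : 0 < T) (hN : 0 < N) {x : ℝ} {i : ℕ}
    (hx : x ∈ Ioc (i * (T / N) : ℝ) ((i + 1 : ℕ) * (T / N))) :
    rightEndpoint T N x = (i + 1 : ℕ) * (T / N) := by
  have hd : 0 < T / N := by positivity
  rw [rightEndpoint, (Nat.ceil_eq_iff (Nat.succ_ne_zero i)).2]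
  simpa [lt_div_iff₀ hd, div_le_iff₀ hd] using hx

theorem abs_rightEndpoint_sub_le {T : ℝ} {N : ℕ} (hT : 0 < T) (hN : 0 < N) {x : ℝ} (hx : 0 < x) :
    |rightEndpoint T N x - x| ≤ T / N := by
  have hd : 0 < T / N := by positivity
  have h1 := (div_le_iff₀ hd).1 (Nat.le_ceil (x / (T / N)))
  have h2 := mul_lt_mul_of_pos_right (Nat.ceil_lt_add_one (div_pos hx hd).le) hd
  rw [add_mul, div_mul_cancel₀ _ hd.ne'] at h2
  rw [rightEndpoint, abs_le]
  constructor <;> linarith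

theorem tendsto_rightEndpoint {T : ℝ} (hT : 0 < T) {x : ℝ} (hx : 0 < x) :
    Tendsto (fun N => rightEndpoint T N x) atTop (𝓝 x) := by
  rw [tendsto_iff_dist_tendsto_zero]
  refine squeeze_zero' (Eventually.of_forall fun _ => dist_nonneg) ?_
    (tendsto_const_div_atTop_nhds_zero_nat T)
  filter_upwards [eventually_gt_atTop 0] with N hN
  exact abs_rightEndpoint_sub_le hT hN hx

theorem integral_comp_rightEndpoint (μ : Measure ℝ) [IsLocallyFiniteMeasure μ] {T : ℝ} {N : ℕ}
    (hT : 0 < T) (hN : 0 < N) (c : ℝ → ℝ) :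
    ∫ x in Ioc 0 T, c (rightEndpoint T N x) ∂μ = ∑ i ∈ Finset.range N,
      c ((i + 1 : ℕ) * (T / N)) * μ.real (Ioc (i * (T / N) : ℝ) ((i + 1 : ℕ) * (T / N))) := by
  have hd : 0 < T / N := by positivity
  have hle : ∀ i : ℕ, (i * (T / N) : ℝ) ≤ (i + 1 : ℕ) * (T / N) := fun i => by
    push_cast; nlinarith
  have heq : ∀ i : ℕ, EqOn (fun x => c (rightEndpoint T N x))
      (fun _ => c ((i + 1 : ℕ) * (T / N))) (Ioc (i * (T / N) : ℝ) ((i + 1 : ℕ) * (T / N))) :=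
    fun i x hx => by simp only [rightEndpoint_eq hT hN hx]
  have key := intervalIntegral.sum_integral_adjacent_intervals (μ := μ)
    (f := fun x => c (rightEndpoint T N x)) (a := fun i : ℕ => (i * (T / N) : ℝ)) (n := N)
    fun i _ => by
      rw [intervalIntegrable_iff_integrableOn_Ioc_of_le (hle i),
        integrableOn_congr_fun (heq i) measurableSet_Ioc]
      exact integrableOn_const measure_Ioc_lt_top.ne
  have hNT : (N * (T / N) : ℝ) = T := by field_simp
  simp only [Nat.cast_zero, zero_mul, hNT] at key
  rw [← intervalIntegral.integral_of_le hT.le, ← key]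
  refine Finset.sum_congr rfl fun i _ => ?_
  rw [intervalIntegral.integral_of_le (hle i), setIntegral_congr_fun measurableSet_Ioc (heq i),
    setIntegral_const, smul_eq_mul, mul_comm]

/-- Continuous functions are dense in `L¹`, and a bounded continuous function is the limit of its
right-endpoint step functions by dominated convergence. -/
theorem exists_comp_rightEndpoint_approx {T : ℝ} (hT : 0 < T) {h : ℝ → ℝ} {A B : ℝ}
    (hh : Measurable h) (hAB : ∀ᵐ x ∂volume.restrict (Ioc 0 T), h x ∈ Icc A B) {ε : ℝ}
    (hε : 0 < ε) :
    ∃ (N : ℕ) (c : ℝ → ℝ), 0 < N ∧ Measurable c ∧ (∀ x, c x ∈ Icc A B) ∧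
      ∫ x in Ioc 0 T, |c (rightEndpoint T N x) - h x| ≤ ε := by
  have hle : A ≤ B := by
    have : (ae (volume.restrict (Ioc 0 T))).NeBot := by
      rw [ae_neBot, Ne, Measure.restrict_eq_zero]
      simpa using hT
    obtain ⟨x, hx⟩ := hAB.exists
    exact hx.1.trans hx.2
  have hhi : Integrable h (volume.restrict (Ioc 0 T)) :=
    Integrable.of_mem_Icc A B hh.aemeasurable hAB
  obtain ⟨φ, -, hφ, hφc, hφi⟩ := hhi.exists_hasCompactSupport_integral_sub_le (half_pos hε)
  -- Truncation to `[A, B]` is 1-Lipschitz and fixes `h` a.e., so it does not increase the error; it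
  -- keeps the step functions at most `B`, as the exponential formula needs when `B < 1`.
  set c : ℝ → ℝ := fun x => max A (min B (φ x)) with hc
  have hcc : Continuous c := by fun_prop
  have hcAB : ∀ x, c x ∈ Icc A B := fun x => ⟨le_max_left _ _, max_le hle (min_le_left _ _)⟩
  have hci : ∀ N, Integrable (fun x => c (rightEndpoint T N x)) (volume.restrict (Ioc 0 T)) :=
    fun N => Integrable.of_mem_Icc A B
      (hcc.measurable.comp (measurable_rightEndpoint T N)).aemeasurable (ae_of_all _ fun x => hcAB _)
  have hci' : Integrable c (volume.restrict (Ioc 0 T)) :=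
    Integrable.of_mem_Icc A B hcc.measurable.aemeasurable (ae_of_all _ hcAB)
  have hlim : Tendsto (fun N => ∫ x in Ioc 0 T, |c (rightEndpoint T N x) - c x|) atTop (𝓝 0) := by
    rw [show 𝓝 (0 : ℝ) = 𝓝 (∫ _ in Ioc 0 T, (0 : ℝ)) by simp]
    refine tendsto_integral_of_dominated_convergence (f := fun _ => (0 : ℝ))
      (F := fun N x => |c (rightEndpoint T N x) - c x|) (fun _ => B - A)
      (fun N => ((hci N).sub hci').abs.aestronglyMeasurable) (integrable_const _)
      (fun N => ae_of_all _ fun x => ?_) ?_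
    · rw [Real.norm_eq_abs, abs_abs, abs_le]
      constructor <;> linarith [(hcAB x).1, (hcAB x).2, (hcAB (rightEndpoint T N x)).1,
        (hcAB (rightEndpoint T N x)).2]
    · filter_upwards [ae_restrict_mem measurableSet_Ioc] with x hx
      have := ((hcc.tendsto x).comp (tendsto_rightEndpoint hT hx.1)).sub_const (c x)
      simpa using this.abs
  obtain ⟨N, hN, hN0⟩ := ((hlim.eventually_le_const (half_pos hε)).and (eventually_gt_atTop 0)).exists
  refine ⟨N, c, hN0, hcc.measurable, hcAB, ?_⟩
  have hch : ∫ x in Ioc 0 T, |c x - h x| ≤ ε / 2 := by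
    refine (integral_mono_ae (hci'.sub hhi).abs (hhi.sub hφi).norm ?_).trans hφ
    filter_upwards [hAB] with x hx
    simp only [Pi.sub_apply, Real.norm_eq_abs, hc]
    rw [abs_sub_comm (h x)]
    have h1 : h x = max A (min B (h x)) := by rw [min_eq_right hx.2, max_eq_right hx.1]
    conv_lhs => rw [h1]
    refine (abs_max_sub_max_le_max _ _ _ _).trans (max_le (by simp) ?_)
    exact (abs_min_sub_min_le_max _ _ _ _).trans (max_le (by simp) le_rfl)
  calc ∫ x in Ioc 0 T, |c (rightEndpoint T N x) - h x|
      ≤ ∫ x in Ioc 0 T, (|c (rightEndpoint T N x) - c x| + |c x - h x|) :=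
        integral_mono ((hci N).sub hhi).abs (((hci N).sub hci').abs.add (hci'.sub hhi).abs)
          fun x => abs_sub_le _ _ _
    _ = _ := integral_add ((hci N).sub hci').abs (hci'.sub hhi).abs
    _ ≤ ε := (add_le_add hN hch).trans (add_halves ε).le

theorem abs_log_one_sub_sub_le {B x y : ℝ} (hB : B < 1) (hx : x ≤ B) (hy : y ≤ B) :
    |Real.log (1 - x) - Real.log (1 - y)| ≤ |x - y| / (1 - B) := by
  have key : ∀ u v : ℝ, u ≤ B → v ≤ B →
      Real.log (1 - u) - Real.log (1 - v) ≤ |u - v| / (1 - B) := by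
    intro u v hu hv
    rw [← Real.log_div (by linarith) (by linarith)]
    refine (Real.log_le_sub_one_of_pos (div_pos (by linarith) (by linarith))).trans ?_
    rw [div_sub_one (by linarith), div_le_div_iff₀ (by linarith) (by linarith)]
    have h1 := neg_abs_le (u - v)
    nlinarith [abs_nonneg (u - v)]
  rw [abs_le]
  have := key x y hx hy
  have h2 := key y x hy hx
  rw [abs_sub_comm] at h2
  constructor <;> linarith

/-! ### The Laplace functional of the Gamma integral. -/

namespace GammaProcess

variable {Ω : Type*} [MeasurableSpace Ω] {P : Measure Ω}

theorem lintegral_exp_integral_comp_rightEndpoint (S : GammaProcess P) {T : ℝ} {N : ℕ} (hT : 0 < T)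
    (hN : 0 < N) {c : ℝ → ℝ} (hc : ∀ x, c x < 1) :
    ∫⁻ ω, ENNReal.ofReal (Real.exp (S.integral (fun x => c (rightEndpoint T N x)) T ω)) ∂P =
      ENNReal.ofReal (Real.exp (∫ x in Ioc 0 T, -Real.log (1 - c (rightEndpoint T N x)))) := by
  have hd : 0 < T / N := by positivity
  have hmono : StrictMono fun i : ℕ => (i * (T / N) : ℝ) := fun i j hij =>
    mul_lt_mul_of_pos_right (Nat.cast_lt.2 hij) hd
  have key := S.lintegral_exp_sum_path_sub hmono (by simp)
    (c := fun i => c ((i + 1 : ℕ) * (T / N))) (fun i => hc _) N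
  rw [integral_comp_rightEndpoint volume hT hN fun y => -Real.log (1 - c y)]
  have hle : ∀ i : ℕ, (i * (T / N) : ℝ) ≤ (i + 1 : ℕ) * (T / N) := fun i =>
    hmono.monotone (Nat.le_succ i)
  simp only [GammaProcess.integral, integral_comp_rightEndpoint _ hT hN c, measureReal_def,
    StieltjesFunction.measure_Ioc, Real.volume_Ioc]
  simp only [ENNReal.toReal_ofReal (sub_nonneg.2 (hle _)),
    ENNReal.toReal_ofReal (sub_nonneg.2 ((S.path _).mono (hle _)))]
  exact key

theorem integrable_jumpMeasure_of_mem_Icc (S : GammaProcess P) {T : ℝ} {h : ℝ → ℝ} {A B : ℝ}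
    (hh : Measurable h) (hAB : ∀ᵐ x ∂volume.restrict (Ioc 0 T), h x ∈ Icc A B) :
    ∀ᵐ ω ∂P, Integrable h (S.jumpMeasure T ω) := by
  filter_upwards [S.ae_ae_jumpMeasure T hAB] with ω hω
  exact Integrable.of_mem_Icc A B hh.aemeasurable hω

theorem eLpNorm_integral_sub_le (S : GammaProcess P) {T : ℝ} {h k : ℝ → ℝ} {A B : ℝ}
    (hh : Measurable h) (hk : Measurable k)
    (hAB : ∀ᵐ x ∂volume.restrict (Ioc 0 T), h x ∈ Icc A B)
    (hkAB : ∀ᵐ x ∂volume.restrict (Ioc 0 T), k x ∈ Icc A B) :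
    eLpNorm (S.integral h T - S.integral k T) 1 P ≤
      ENNReal.ofReal (∫ x in Ioc 0 T, |h x - k x|) := by
  have hhi : Integrable h (volume.restrict (Ioc 0 T)) :=
    Integrable.of_mem_Icc A B hh.aemeasurable hAB
  have hki : Integrable k (volume.restrict (Ioc 0 T)) :=
    Integrable.of_mem_Icc A B hk.aemeasurable hkAB
  rw [eLpNorm_one_eq_lintegral_enorm,
    ofReal_integral_eq_lintegral_ofReal (f := fun x => |h x - k x|) (hhi.sub hki).abs
      (ae_of_all _ fun _ => abs_nonneg _)]
  have hm : Measurable fun x => ENNReal.ofReal |h x - k x| := by fun_prop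
  refine le_trans ?_ (S.lintegral_lintegral_jumpMeasure T hm).le
  refine lintegral_mono_ae ?_
  filter_upwards [S.integrable_jumpMeasure_of_mem_Icc hh hAB,
    S.integrable_jumpMeasure_of_mem_Icc hk hkAB] with ω h1 h2
  rw [Pi.sub_apply, integral_eq, integral_eq, ← integral_sub h1 h2]
  refine (enorm_integral_le_lintegral_enorm _).trans (lintegral_mono fun x => ?_)
  rw [Real.enorm_eq_ofReal_abs]

/-- Approximation in `L¹(dx)` passes to the integrals in `L¹(P)` by Campbell's formula, hence to
almost sure convergence along a subsequence. The exponents converge because `log(1 - x)` is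
Lipschitz with constant `1 / (1 - B)` on `x ≤ B`. -/
theorem exists_seq_tendsto_integral (S : GammaProcess P) {T : ℝ} (hT : 0 < T) {h : ℝ → ℝ} {A B : ℝ}
    (hB : B < 1) (hh : Measurable h) (hAB : ∀ᵐ x ∂volume.restrict (Ioc 0 T), h x ∈ Icc A B) :
    ∃ s : ℕ → ℝ → ℝ, (∀ n, Measurable (s n)) ∧ (∀ n x, s n x ∈ Icc A B) ∧
      (∀ n, ∫⁻ ω, ENNReal.ofReal (Real.exp (S.integral (s n) T ω)) ∂P =
        ENNReal.ofReal (Real.exp (∫ x in Ioc 0 T, -Real.log (1 - s n x)))) ∧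
      Tendsto (fun n => ∫ x in Ioc 0 T, -Real.log (1 - s n x)) atTop
        (𝓝 (∫ x in Ioc 0 T, -Real.log (1 - h x))) ∧
      ∀ᵐ ω ∂P, Tendsto (fun n => S.integral (s n) T ω) atTop (𝓝 (S.integral h T ω)) := by
  choose N c hN hc hcAB hch using fun n : ℕ => exists_comp_rightEndpoint_approx hT hh hAB
    (Nat.one_div_pos_of_nat (α := ℝ) (n := n))
  set s : ℕ → ℝ → ℝ := fun n x => c n (rightEndpoint T (N n) x) with hs
  have hsm : ∀ n, Measurable (s n) := fun n => (hc n).comp (measurable_rightEndpoint T _)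
  have hsAB : ∀ n x, s n x ∈ Icc A B := fun n x => hcAB n _
  have hhi : Integrable h (volume.restrict (Ioc 0 T)) :=
    Integrable.of_mem_Icc A B hh.aemeasurable hAB
  have hsi : ∀ n, Integrable (s n) (volume.restrict (Ioc 0 T)) := fun n =>
    Integrable.of_mem_Icc A B (hsm n).aemeasurable (ae_of_all _ (hsAB n))
  have hL1 : Tendsto (fun n => ∫ x in Ioc 0 T, |s n x - h x|) atTop (𝓝 0) :=
    squeeze_zero (fun n => integral_nonneg fun _ => abs_nonneg _) hch
      tendsto_one_div_add_atTop_nhds_zero_nat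
  have hmeas : TendstoInMeasure P (fun n => S.integral (s n) T) atTop (S.integral h T) := by
    refine tendstoInMeasure_of_tendsto_eLpNorm one_ne_zero
      (fun n => (S.measurable_integral T (hsm n)).aestronglyMeasurable)
      (S.measurable_integral T hh).aestronglyMeasurable ?_
    refine tendsto_of_tendsto_of_tendsto_of_le_of_le tendsto_const_nhds ?_ (fun _ => zero_le)
      fun n => S.eLpNorm_integral_sub_le (hsm n) hh (ae_of_all _ (hsAB n)) hAB
    simpa using ENNReal.tendsto_ofReal hL1
  have hlog : ∀ k : ℝ → ℝ, Measurable k → (∀ᵐ x ∂volume.restrict (Ioc 0 T), k x ∈ Icc A B) →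
      Integrable (fun x => -Real.log (1 - k x)) (volume.restrict (Ioc 0 T)) := by
    intro k hk hkAB
    refine Integrable.of_mem_Icc (-Real.log (1 - A)) (-Real.log (1 - B)) (by fun_prop) ?_
    filter_upwards [hkAB] with x hx
    exact ⟨neg_le_neg (Real.log_le_log (by linarith [hx.2]) (by linarith [hx.1])),
      neg_le_neg (Real.log_le_log (by linarith) (by linarith [hx.2]))⟩
  have hlim : Tendsto (fun n => ∫ x in Ioc 0 T, -Real.log (1 - s n x)) atTop
      (𝓝 (∫ x in Ioc 0 T, -Real.log (1 - h x))) := by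
    rw [tendsto_iff_norm_sub_tendsto_zero]
    have hb := hL1.div_const (1 - B)
    rw [zero_div] at hb
    refine squeeze_zero (fun _ => norm_nonneg _) (fun n => ?_) hb
    rw [← integral_sub (hlog _ (hsm n) (ae_of_all _ (hsAB n))) (hlog h hh hAB), ← integral_div]
    refine norm_integral_le_of_norm_le (((hsi n).sub hhi).abs.div_const _) ?_
    filter_upwards [hAB] with x hx
    rw [Real.norm_eq_abs, neg_sub_neg, abs_sub_comm]
    exact abs_log_one_sub_sub_le hB (hsAB n x).2 hx.2
  obtain ⟨ns, hns, hae⟩ := hmeas.exists_seq_tendsto_ae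
  exact ⟨fun n => s (ns n), fun n => hsm _, fun n => hsAB _,
    fun n => S.lintegral_exp_integral_comp_rightEndpoint hT (hN _)
      fun x => (hcAB (ns n) x).2.trans_lt hB, hlim.comp hns.tendsto_atTop, hae⟩

/-- Fatou's lemma along the approximating sequence. The inequality suffices for bounding exponential
moments from above. -/
theorem lintegral_exp_integral_le (S : GammaProcess P) {T : ℝ} (hT : 0 < T) {h : ℝ → ℝ} {A B : ℝ}
    (hB : B < 1) (hh : Measurable h) (hAB : ∀ᵐ x ∂volume.restrict (Ioc 0 T), h x ∈ Icc A B) :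
    ∫⁻ ω, ENNReal.ofReal (Real.exp (S.integral h T ω)) ∂P ≤
      ENNReal.ofReal (Real.exp (∫ x in Ioc 0 T, -Real.log (1 - h x))) := by
  obtain ⟨s, hsm, -, hexp, hlim, hae⟩ := S.exists_seq_tendsto_integral hT hB hh hAB
  have hae' : ∀ᵐ ω ∂P, ENNReal.ofReal (Real.exp (S.integral h T ω)) =
      liminf (fun n => ENNReal.ofReal (Real.exp (S.integral (s n) T ω))) atTop := by
    filter_upwards [hae] with ω hω
    exact (ENNReal.tendsto_ofReal ((Real.continuous_exp.tendsto _).comp hω)).liminf_eq.symm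
  rw [lintegral_congr_ae hae']
  refine (lintegral_liminf_le fun n =>
    (S.measurable_integral T (hsm n)).exp.ennreal_ofReal).trans ?_
  simp only [hexp]
  exact (ENNReal.tendsto_ofReal ((Real.continuous_exp.tendsto _).comp hlim)).liminf_eq.le

/-- For nonpositive integrands the exponentials are at most `1`, so dominated convergence gives
equality; the lower bound is what the argument from orderly divergence requires. -/
theorem lintegral_exp_integral_eq_of_nonpos (S : GammaProcess P) [IsProbabilityMeasure P] {T : ℝ}
    (hT : 0 < T) {h : ℝ → ℝ} {A : ℝ} (hh : Measurable h)
    (hA : ∀ᵐ x ∂volume.restrict (Ioc 0 T), h x ∈ Icc A 0) :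
    ∫⁻ ω, ENNReal.ofReal (Real.exp (S.integral h T ω)) ∂P =
      ENNReal.ofReal (Real.exp (∫ x in Ioc 0 T, -Real.log (1 - h x))) := by
  obtain ⟨s, hsm, hsA, hexp, hlim, hae⟩ := S.exists_seq_tendsto_integral hT one_pos hh hA
  refine tendsto_nhds_unique (tendsto_lintegral_of_dominated_convergence
    (F := fun n ω => ENNReal.ofReal (Real.exp (S.integral (s n) T ω))) (fun _ => 1)
    (fun n => (S.measurable_integral T (hsm n)).exp.ennreal_ofReal)
    (fun n => ae_of_all _ fun ω => ?_) (by simp) ?_) ?_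
  · rw [ENNReal.ofReal_le_one, Real.exp_le_one_iff]
    exact integral_nonpos fun x => (hsA n x).2
  · filter_upwards [hae] with ω hω
    exact ENNReal.tendsto_ofReal ((Real.continuous_exp.tendsto _).comp hω)
  · simp only [hexp]
    exact ENNReal.tendsto_ofReal ((Real.continuous_exp.tendsto _).comp hlim)

end GammaProcess

/-! ### From `v_t → 0` to `b_t → 0`. -/

theorem cumul_eq_setIntegral (f : ℝ → ℝ) {t : ℝ} (ht : 0 ≤ t) :
    cumul f t = ∫ x in Ioc 0 t, f x := intervalIntegral.integral_of_le ht

/-- Since `F t ≤ x`, where `x` is the integral over `[t, t+1]`, the bound `x ≤ w (λ_t F + x)` can be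
solved for `x`. -/
theorem bChar_le_of_increment {F : ℝ → ℝ} (hF : Monotone F) {t w : ℝ} (hpos : 0 < cumul F t)
    (hw : (∫ x in t..t + 1, F x) / cumul F (t + 1) ≤ w) (hw1 : w < 1) :
    bChar F t ≤ w / (1 - w) := by
  have hadd : cumul F t + ∫ x in t..t + 1, F x = cumul F (t + 1) :=
    intervalIntegral.integral_add_adjacent_intervals hF.intervalIntegrable hF.intervalIntegrable
  have hge : F t ≤ ∫ x in t..t + 1, F x := by
    have := intervalIntegral.integral_mono_on (μ := volume) (a := t) (b := t + 1)
      (f := fun _ => F t) (g := F) (by linarith) (by simp) hF.intervalIntegrable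
      fun x hx => hF hx.1
    simpa using this
  set x := ∫ x in t..t + 1, F x
  rw [bChar, div_le_div_iff₀ hpos (by linarith)]
  -- Nonnegativity of `F` is not assumed. A negative `λ_{t+1} F` would make the ratio exceed `1 >
  -- w`; when it is zero the ratio has default value `0`, and `F t` is negative.
  rcases le_or_gt (cumul F (t + 1)) 0 with h | h
  · rcases h.lt_or_eq with h | h
    · rw [div_le_iff_of_neg h] at hw
      nlinarith
    · rw [h, div_zero] at hw
      nlinarith
  · rw [div_le_iff₀ h, ← hadd] at hw
    nlinarith

theorem tendsto_bChar_of_increment {F : ℝ → ℝ} (hF : Monotone F) (h0 : ∀ x, 0 ≤ F x)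
    (hlim : Tendsto (cumul F) atTop atTop)
    (hw : Tendsto (fun t => (∫ x in t..t + 1, F x) / cumul F (t + 1)) atTop (𝓝 0)) :
    Tendsto (bChar F) atTop (𝓝 0) := by
  have hup := hw.div (tendsto_const_nhds (x := (1 : ℝ)).sub hw) (by norm_num)
  rw [zero_div] at hup
  refine squeeze_zero' ?_ ?_ hup
  · filter_upwards [hlim.eventually_gt_atTop 0] with t ht
    exact div_nonneg (h0 t) ht.le
  · filter_upwards [hlim.eventually_gt_atTop 0, hw.eventually_lt_const one_pos] with t ht ht1
    exact bChar_le_of_increment hF ht le_rfl ht1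

theorem Monotone.sq_of_nonneg {F : ℝ → ℝ} (hF : Monotone F) (h0 : ∀ x, 0 ≤ F x) :
    Monotone fun x => F x ^ 2 := fun x _ hxy => pow_le_pow_left₀ (h0 x) (hF hxy) 2

/-- The variance of `F` over a unit interval is nonnegative. -/
theorem sq_integral_le_integral_sq {F : ℝ → ℝ} {t : ℝ}
    (hF : IntervalIntegrable F volume t (t + 1))
    (hF2 : IntervalIntegrable (fun x => F x ^ 2) volume t (t + 1)) :
    (∫ x in t..t + 1, F x) ^ 2 ≤ ∫ x in t..t + 1, F x ^ 2 := by
  set m := ∫ x in t..t + 1, F x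
  have h : 0 ≤ ∫ x in t..t + 1, (F x - m) ^ 2 :=
    intervalIntegral.integral_nonneg (by linarith) fun x _ => sq_nonneg _
  have he : ∀ x, (F x - m) ^ 2 = F x ^ 2 - 2 * m * F x + m ^ 2 := fun x => by ring
  simp only [he] at h
  rw [intervalIntegral.integral_add (hF2.sub (hF.const_mul _)) (by simp),
    intervalIntegral.integral_sub hF2 (hF.const_mul _), intervalIntegral.integral_const_mul,
    intervalIntegral.integral_const] at h
  simp only [add_sub_cancel_left, one_smul] at h
  nlinarith

theorem tendsto_bChar_of_tendsto_vChar {F : ℝ → ℝ} (hF : Monotone F) (h0 : ∀ x, 0 ≤ F x)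
    (hlim : Tendsto (cumul F) atTop atTop) (hv : Tendsto (vChar F) atTop (𝓝 0)) :
    Tendsto (bChar F) atTop (𝓝 0) := by
  refine tendsto_bChar_of_increment hF h0 hlim ?_
  have hs : Tendsto (fun t => √(vChar F (t + 1))) atTop (𝓝 0) := by
    have := (hv.comp (tendsto_atTop_add_const_right atTop (1 : ℝ) tendsto_id)).sqrt
    simpa using this
  have hlim1 := hlim.comp (tendsto_atTop_add_const_right atTop (1 : ℝ) tendsto_id)
  have hF2 := hF.sq_of_nonneg h0
  refine squeeze_zero' ?_ ?_ hs
  · filter_upwards [hlim1.eventually_gt_atTop 0] with t (ht : 0 < cumul F (t + 1))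
    exact div_nonneg (intervalIntegral.integral_nonneg (by linarith) fun x _ => h0 x) ht.le
  · filter_upwards [hlim1.eventually_gt_atTop 0, eventually_ge_atTop 0] with t
      (ht : 0 < cumul F (t + 1)) ht0
    refine Real.le_sqrt_of_sq_le ?_
    rw [div_pow, vChar]
    gcongr
    refine (sq_integral_le_integral_sq hF.intervalIntegrable hF2.intervalIntegrable).trans ?_
    have hadd : cumul (fun x => F x ^ 2) t + ∫ x in t..t + 1, F x ^ 2 =
        cumul (fun x => F x ^ 2) (t + 1) :=
      intervalIntegral.integral_add_adjacent_intervals hF2.intervalIntegrable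
        hF2.intervalIntegrable
    have : 0 ≤ cumul (fun x => F x ^ 2) t :=
      intervalIntegral.integral_nonneg ht0 fun x _ => sq_nonneg _
    linarith

/-! ### Comparison of `λ_t(Fg)` with `λ_t F`. -/

namespace IsRegularPeriodicFactor

variable {g : ℝ → ℝ}

theorem ae_le_one (hg : IsRegularPeriodicFactor g) : ∀ᵐ x, g x ≤ 1 := by
  by_cases hb : IsBoundedUnder (· ≤ ·) (ae volume) g
  · have := ae_le_essSup (μ := volume) (f := g) hb
    rwa [hg.essSup_eq_one] at this
  -- If `g` had no a.e. upper bound, its essential supremum would be the infimum of the empty set,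
  -- which is `0` by default and not `1`.
  · have h1 := hg.essSup_eq_one
    rw [essSup, limsup_eq] at h1
    have : {a | ∀ᶠ n in ae volume, g n ≤ a} = ∅ := by
      refine eq_empty_of_forall_notMem fun a ha => hb ⟨a, ?_⟩
      simpa using ha
    rw [this, Real.sInf_empty] at h1
    norm_num at h1

theorem intervalIntegrable (hg : IsRegularPeriodicFactor g) (a b : ℝ) :
    IntervalIntegrable g volume a b := by
  refine (intervalIntegrable_const (c := (1 : ℝ))).mono_fun' hg.measurable.aestronglyMeasurable ?_
  filter_upwards [ae_restrict_of_ae hg.ae_le_one] with x hx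
  rwa [Real.norm_of_nonneg (hg.nonneg x)]

theorem integral_period_pos (hg : IsRegularPeriodicFactor g) {T : ℝ} (hT : 0 < T)
    (hp : Function.Periodic g T) : 0 < ∫ x in (0 : ℝ)..T, g x := by
  refine (intervalIntegral.integral_nonneg hT.le fun x _ => hg.nonneg x).lt_of_ne fun h0 => ?_
  have hz : ∀ n : ℕ, ∀ᵐ x ∂volume.restrict (Ioc (-(n * T)) (n * T)), g x = 0 := by
    intro n
    have h := hp.intervalIntegral_add_zsmul_eq (2 * n : ℤ) (-(n * T)) hg.intervalIntegrable
    have he := hp.intervalIntegral_add_eq (-(n * T)) 0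
    rw [zero_add, ← h0] at he
    rw [he, smul_zero, show -(n * T) + (2 * n : ℤ) • T = n * T by simp; ring,
      intervalIntegral.integral_of_le (by nlinarith [n.cast_nonneg (α := ℝ)]),
      integral_eq_zero_iff_of_nonneg hg.nonneg] at h
    · exact h
    · exact (hg.intervalIntegrable _ _).1
  have hU : (⋃ n : ℕ, Ioc (-(n * T)) (n * T)) = univ := by
    refine eq_univ_of_forall fun x => mem_iUnion.2 ?_
    obtain ⟨n, hn⟩ := exists_nat_gt (|x| / T)
    rw [div_lt_iff₀ hT, abs_lt] at hn
    exact ⟨n, hn.1, hn.2.le⟩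
  have hall : g =ᵐ[volume] fun _ => 0 := by
    have := (ae_restrict_iUnion_iff (μ := volume) (fun n : ℕ => Ioc (-(n * T)) (n * T))
      (fun x => g x = 0)).2 hz
    rwa [hU, Measure.restrict_univ] at this
  have h1 := hg.essSup_eq_one
  rw [essSup_congr_ae hall, essSup_const' _] at h1
  · norm_num at h1

theorem intervalIntegrable_mul (hg : IsRegularPeriodicFactor g) {F : ℝ → ℝ} (hF : Monotone F)
    (h0 : ∀ x, 0 ≤ F x) (a b : ℝ) : IntervalIntegrable (fun x => F x * g x) volume a b := by
  refine (hF.intervalIntegrable (a := a) (b := b)).mono_fun'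
    (hF.measurable.mul hg.measurable).aestronglyMeasurable ?_
  filter_upwards [ae_restrict_of_ae hg.ae_le_one] with x hx
  rw [Real.norm_of_nonneg (mul_nonneg (h0 x) (hg.nonneg x))]
  exact mul_le_of_le_one_right (h0 x) hx

/-- The value `F (a + T)` is the pivot: it bounds `F` from above on the period before `a + T` and
from below on the period after. -/
theorem integral_mul_period_ge (hg : IsRegularPeriodicFactor g) {T : ℝ} (hT : 0 < T)
    (hp : Function.Periodic g T) {F : ℝ → ℝ} (hF : Monotone F) (h0 : ∀ x, 0 ≤ F x) (a : ℝ) :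
    ((∫ x in (0 : ℝ)..T, g x) / T) * ∫ x in a..a + T, F x ≤
      ∫ x in a + T..a + T + T, F x * g x := by
  have hm := hg.integral_period_pos hT hp
  have h1 : ∫ x in a..a + T, F x ≤ T * F (a + T) := by
    have := intervalIntegral.integral_mono_on (μ := volume) (a := a) (b := a + T)
      (f := F) (g := fun _ => F (a + T)) (by linarith) hF.intervalIntegrable (by simp)
      fun x hx => hF hx.2
    simpa using this
  have h2 : F (a + T) * (∫ x in (0 : ℝ)..T, g x) ≤ ∫ x in a + T..a + T + T, F x * g x := by
    have he := hp.intervalIntegral_add_eq 0 (a + T)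
    rw [zero_add] at he
    rw [he, ← intervalIntegral.integral_const_mul]
    refine intervalIntegral.integral_mono_on (by linarith) ((hg.intervalIntegrable _ _).const_mul _)
      (hg.intervalIntegrable_mul hF h0 _ _) fun x hx => ?_
    exact mul_le_mul_of_nonneg_right (hF hx.1) (hg.nonneg x)
  calc _ ≤ ((∫ x in (0 : ℝ)..T, g x) / T) * (T * F (a + T)) := by gcongr
    _ = F (a + T) * ∫ x in (0 : ℝ)..T, g x := by field_simp
    _ ≤ _ := h2

theorem cumul_nat_mul_le (hg : IsRegularPeriodicFactor g) {T : ℝ} (hT : 0 < T)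
    (hp : Function.Periodic g T) {F : ℝ → ℝ} (hF : Monotone F) (h0 : ∀ x, 0 ≤ F x) (n : ℕ) :
    ((∫ x in (0 : ℝ)..T, g x) / T) * cumul F (n * T) ≤
      cumul (fun x => F x * g x) (n * T + T) := by
  induction n with
  | zero =>
    simp only [cumul, Nat.cast_zero, zero_mul, intervalIntegral.integral_same, mul_zero]
    exact intervalIntegral.integral_nonneg (by linarith) fun x _ =>
      mul_nonneg (h0 x) (hg.nonneg x)
  | succ n ih =>
    have h := hg.integral_mul_period_ge hT hp hF h0 (n * T)
    have e1 : cumul F (n * T) + ∫ x in n * T..n * T + T, F x = cumul F (n * T + T) :=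
      intervalIntegral.integral_add_adjacent_intervals hF.intervalIntegrable hF.intervalIntegrable
    have e2 : cumul (fun x => F x * g x) (n * T + T) + ∫ x in n * T + T..n * T + T + T, F x * g x =
        cumul (fun x => F x * g x) (n * T + T + T) :=
      intervalIntegral.integral_add_adjacent_intervals (hg.intervalIntegrable_mul hF h0 _ _)
        (hg.intervalIntegrable_mul hF h0 _ _)
    rw [Nat.cast_succ, add_mul, one_mul, ← e1, ← e2, mul_add]
    exact add_le_add ih h

theorem cumul_mul_ge (hg : IsRegularPeriodicFactor g) {T : ℝ} (hT : 0 < T)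
    (hp : Function.Periodic g T) {F : ℝ → ℝ} (hF : Monotone F) (h0 : ∀ x, 0 ≤ F x) {t : ℝ}
    (ht : T ≤ t) :
    ((∫ x in (0 : ℝ)..T, g x) / T) * (cumul F t - 2 * T * F t) ≤
      cumul (fun x => F x * g x) t := by
  have hm := hg.integral_period_pos hT hp
  have ht0 : 0 ≤ t := hT.le.trans ht
  -- With `n + 1` whole periods in `[0, t]`, one is spent on the shift, so `λ F` is compared up to
  -- `n * T`; the rest has length at most `2 * T`.
  obtain ⟨n, hn⟩ : ∃ n : ℕ, ⌊t / T⌋₊ = n + 1 :=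
    Nat.exists_eq_add_one.2 (Nat.floor_pos.2 ((one_le_div hT).2 ht))
  have hn1 : n * T + T ≤ t := by
    have := Nat.floor_le (div_nonneg ht0 hT.le)
    rw [hn, le_div_iff₀ hT] at this
    push_cast at this
    linarith
  have hn2 : t ≤ n * T + 2 * T := by
    have := (Nat.lt_floor_add_one (t / T)).le
    rw [hn, div_le_iff₀ hT] at this
    push_cast at this
    linarith
  have hnt : (n : ℝ) * T ≤ t := by linarith
  have e1 : cumul F (n * T) + ∫ x in n * T..t, F x = cumul F t :=
    intervalIntegral.integral_add_adjacent_intervals hF.intervalIntegrable hF.intervalIntegrable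
  have e2 : cumul (fun x => F x * g x) (n * T + T) + ∫ x in n * T + T..t, F x * g x =
      cumul (fun x => F x * g x) t :=
    intervalIntegral.integral_add_adjacent_intervals (hg.intervalIntegrable_mul hF h0 _ _)
      (hg.intervalIntegrable_mul hF h0 _ _)
  have h1 : ∫ x in n * T..t, F x ≤ (t - n * T) * F t := by
    have := intervalIntegral.integral_mono_on (μ := volume) (a := n * T) (b := t)
      (f := F) (g := fun _ => F t) hnt hF.intervalIntegrable (by simp)
      fun x hx => hF hx.2
    simpa using this
  have h2 : 0 ≤ ∫ x in n * T + T..t, F x * g x :=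
    intervalIntegral.integral_nonneg hn1 fun x _ => mul_nonneg (h0 x) (hg.nonneg x)
  have h3 : (t - n * T) * F t ≤ 2 * T * F t :=
    mul_le_mul_of_nonneg_right (by linarith) (h0 t)
  calc _ ≤ ((∫ x in (0 : ℝ)..T, g x) / T) * cumul F (n * T) := by
        refine mul_le_mul_of_nonneg_left ?_ (div_nonneg hm.le hT.le)
        linarith
    _ ≤ cumul (fun x => F x * g x) (n * T + T) := hg.cumul_nat_mul_le hT hp hF h0 n
    _ ≤ _ := by linarith

theorem exists_cumul_mul_ge (hg : IsRegularPeriodicFactor g) :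
    ∃ c : ℝ, 0 < c ∧ ∀ F : ℝ → ℝ, Monotone F → (∀ x, 0 ≤ F x) →
      Tendsto (cumul F) atTop atTop → Tendsto (bChar F) atTop (𝓝 0) →
        ∀ᶠ t in atTop, c * cumul F t ≤ cumul (fun x => F x * g x) t := by
  obtain ⟨T, hT, hp⟩ := hg.periodic
  have hm := hg.integral_period_pos hT hp
  -- The constant is half the mean of `g`: once `b_t ≤ 1 / (4T)`, the loss `2 T F(t)` is at most
  -- half of `λ_t F`.
  refine ⟨(∫ x in (0 : ℝ)..T, g x) / T / 2, by positivity, fun F hF h0 hlim hb => ?_⟩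
  filter_upwards [eventually_ge_atTop T, hlim.eventually_gt_atTop 0,
    hb.eventually_le_const (show 0 < 1 / (4 * T) by positivity)] with t ht hpos hbt
  refine le_trans ?_ (hg.cumul_mul_ge hT hp hF h0 ht)
  rw [bChar, div_le_div_iff₀ hpos (by positivity)] at hbt
  rw [div_mul_eq_mul_div, mul_div_assoc]
  refine mul_le_mul_of_nonneg_left ?_ (by positivity)
  linarith

theorem vChar_mul_le (hg : IsRegularPeriodicFactor g) {F : ℝ → ℝ} (hF : Monotone F)
    (h0 : ∀ x, 0 ≤ F x) {c t : ℝ} (hc : 0 < c) (ht : 0 ≤ t) (hpos : 0 < cumul F t)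
    (hle : c * cumul F t ≤ cumul (fun x => F x * g x) t) :
    vChar (fun x => F x * g x) t ≤ 1 / c ^ 2 * vChar F t := by
  have hF2 := hF.sq_of_nonneg h0
  have h2 : cumul (fun x => (F x * g x) ^ 2) t ≤ cumul (fun x => F x ^ 2) t := by
    have hae : ∀ᵐ x, (F x * g x) ^ 2 ≤ F x ^ 2 := by
      filter_upwards [hg.ae_le_one] with x hx
      exact pow_le_pow_left₀ (mul_nonneg (h0 x) (hg.nonneg x))
        (mul_le_of_le_one_right (h0 x) hx) 2
    refine intervalIntegral.integral_mono_ae ht ?_ hF2.intervalIntegrable hae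
    refine hF2.intervalIntegrable.mono_fun'
      ((hF.measurable.mul hg.measurable).pow_const 2).aestronglyMeasurable ?_
    filter_upwards [ae_restrict_of_ae hae] with x hx
    rwa [Real.norm_of_nonneg (sq_nonneg _)]
  have h2' : 0 ≤ cumul (fun x => F x ^ 2) t :=
    intervalIntegral.integral_nonneg ht fun x _ => sq_nonneg _
  calc vChar (fun x => F x * g x) t
      ≤ cumul (fun x => F x ^ 2) t / (c * cumul F t) ^ 2 := by
        rw [vChar]
        gcongr
    _ = _ := by rw [vChar]; field_simp

end IsRegularPeriodicFactor

/-! ### From orderly divergence in probability to `b_t → 0`. -/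

theorem log_one_add_le_tangent {a y : ℝ} (ha : 0 ≤ a) (hy : 0 ≤ y) :
    Real.log (1 + y) ≤ Real.log (1 + a) + (y - a) / (1 + a) := by
  have h := Real.log_le_sub_one_of_pos (div_pos (show 0 < 1 + y by linarith)
    (show 0 < 1 + a by linarith))
  rw [Real.log_div (by linarith) (by linarith), div_sub_one (by linarith)] at h
  have : (1 + y - (1 + a)) / (1 + a) = (y - a) / (1 + a) := by ring
  linarith

theorem sub_log_one_add_mono {a b : ℝ} (ha : 0 ≤ a) (hab : a ≤ b) :
    a - Real.log (1 + a) ≤ b - Real.log (1 + b) := by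
  have h := log_one_add_le_tangent ha (ha.trans hab)
  have : (b - a) / (1 + a) ≤ b - a := div_le_self (by linarith) (by linarith)
  linarith

theorem neg_log_one_sub_le {h : ℝ} (hh : |h| ≤ 1 / 2) : -Real.log (1 - h) ≤ h + 2 * h ^ 2 := by
  obtain ⟨h1, h2⟩ := abs_le.1 hh
  have hpos : 0 < 1 - h := by linarith
  have := Real.one_sub_inv_le_log_of_pos hpos
  have h3 : (1 - h)⁻¹ ≤ 1 + h + 2 * h ^ 2 := by
    rw [inv_le_iff_one_le_mul₀ hpos]
    nlinarith [sq_nonneg h]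
  linarith

/-- On `[0, t]` use `log(1 + y) ≤ y`; on `[t, t+1]` use the tangent at the mean `a`, which is
Jensen's inequality. As `F / L` has total integral `1`, the gain is `a - log(1 + a)`. -/
theorem integral_log_one_add_div_le {F : ℝ → ℝ} (hF : Monotone F) (h0 : ∀ x, 0 ≤ F x) {t : ℝ}
    (ht : 0 ≤ t) (hpos : 0 < cumul F (t + 1)) :
    ∫ x in Ioc 0 (t + 1), Real.log (1 + F x / cumul F (t + 1)) ≤
      1 - ((∫ x in t..t + 1, F x) / cumul F (t + 1) -
        Real.log (1 + (∫ x in t..t + 1, F x) / cumul F (t + 1))) := by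
  set L := cumul F (t + 1) with hL
  set a := (∫ x in t..t + 1, F x) / L with ha
  have ha0 : 0 ≤ a :=
    div_nonneg (intervalIntegral.integral_nonneg (by linarith) fun x _ => h0 x) hpos.le
  have hG0 : ∀ x, 0 ≤ F x / L := fun x => div_nonneg (h0 x) hpos.le
  have hG : Monotone fun x => F x / L := fun x y hxy => div_le_div_of_nonneg_right (hF hxy) hpos.le
  have hlog : Monotone fun x => Real.log (1 + F x / L) := fun x y hxy =>
    Real.log_le_log (by linarith [hG0 x]) (add_le_add_right (hG hxy) 1)
  have e1 := intervalIntegral.integral_add_adjacent_intervals (μ := volume)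
    (hlog.intervalIntegrable (a := 0) (b := t)) (hlog.intervalIntegrable (a := t) (b := t + 1))
  have e2 := intervalIntegral.integral_add_adjacent_intervals (μ := volume)
    (hG.intervalIntegrable (a := 0) (b := t)) (hG.intervalIntegrable (a := t) (b := t + 1))
  have e3 : ∫ x in (0 : ℝ)..t + 1, F x / L = 1 := by
    rw [intervalIntegral.integral_div]
    exact div_self hpos.ne'
  have e4 : ∫ x in t..t + 1, F x / L = a := intervalIntegral.integral_div _ _
  have b1 : ∫ x in (0 : ℝ)..t, Real.log (1 + F x / L) ≤ ∫ x in (0 : ℝ)..t, F x / L :=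
    intervalIntegral.integral_mono_on ht hlog.intervalIntegrable hG.intervalIntegrable fun x _ => by
      have := Real.log_le_sub_one_of_pos (show 0 < 1 + F x / L by linarith [hG0 x])
      linarith
  have b2 : ∫ x in t..t + 1, Real.log (1 + F x / L) ≤
      ∫ x in t..t + 1, (Real.log (1 + a) + (F x / L - a) / (1 + a)) :=
    intervalIntegral.integral_mono_on (by linarith) hlog.intervalIntegrable
      (by simp [((hG.intervalIntegrable.sub intervalIntegrable_const).div_const _)])
      fun x _ => log_one_add_le_tangent ha0 (hG0 x)
  have b3 : ∫ x in t..t + 1, (Real.log (1 + a) + (F x / L - a) / (1 + a)) = Real.log (1 + a) := by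
    rw [intervalIntegral.integral_add intervalIntegrable_const
      ((hG.intervalIntegrable.sub intervalIntegrable_const).div_const _),
      intervalIntegral.integral_div, intervalIntegral.integral_sub hG.intervalIntegrable
      intervalIntegrable_const, e4]
    simp
  rw [← intervalIntegral.integral_of_le (by linarith), ← e1]
  linarith

theorem lintegral_exp_neg_le {Ω : Type*} [MeasurableSpace Ω] (P : Measure Ω)
    [IsProbabilityMeasure P] {R : Ω → ℝ} (hR : Measurable R) (hR0 : ∀ᵐ ω ∂P, 0 ≤ R ω) {ε : ℝ} :
    ∫⁻ ω, ENNReal.ofReal (Real.exp (-R ω)) ∂P ≤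
      ENNReal.ofReal (Real.exp (-1 + ε)) + P {ω | ENNReal.ofReal ε ≤ edist (R ω) 1} := by
  have hs : MeasurableSet {ω | ENNReal.ofReal ε ≤ edist (R ω) 1} :=
    measurableSet_le measurable_const (by fun_prop)
  calc ∫⁻ ω, ENNReal.ofReal (Real.exp (-R ω)) ∂P
      ≤ ∫⁻ ω, (ENNReal.ofReal (Real.exp (-1 + ε)) +
          {ω | ENNReal.ofReal ε ≤ edist (R ω) 1}.indicator 1 ω) ∂P := by
        refine lintegral_mono_ae ?_
        filter_upwards [hR0] with ω hω
        by_cases h : ω ∈ {ω | ENNReal.ofReal ε ≤ edist (R ω) 1}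
        · rw [indicator_of_mem h, Pi.one_apply]
          refine le_add_left (ENNReal.ofReal_le_one.2 ?_)
          rw [Real.exp_le_one_iff]
          linarith
        · rw [indicator_of_notMem h, add_zero]
          rw [mem_ofPred_eq, edist_dist, not_le, ENNReal.ofReal_lt_ofReal_iff', Real.dist_eq] at h
          have := neg_abs_le (R ω - 1)
          exact ENNReal.ofReal_le_ofReal (Real.exp_le_exp.2 (by linarith [h.1]))
    _ = _ := by
        rw [lintegral_add_left measurable_const, lintegral_indicator_one hs]
        simp

namespace GammaProcess

variable {Ω : Type*} [MeasurableSpace Ω] {P : Measure Ω}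

theorem lintegral_exp_neg_ratio (S : GammaProcess P) [IsProbabilityMeasure P] {F : ℝ → ℝ}
    (hF : Monotone F) (h0 : ∀ x, 0 ≤ F x) {T L : ℝ} (hT : 0 < T) (hL : 0 < L) :
    ∫⁻ ω, ENNReal.ofReal (Real.exp (-(S.integral F T ω / L))) ∂P =
      ENNReal.ofReal (Real.exp (-∫ x in Ioc 0 T, Real.log (1 + F x / L))) := by
  have h := S.lintegral_exp_integral_eq_of_nonpos hT (h := fun x => -(F x / L)) (A := -(F T / L))
    (hF.measurable.div_const _).neg (by
      filter_upwards [ae_restrict_mem measurableSet_Ioc] with x hx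
      exact ⟨neg_le_neg (div_le_div_of_nonneg_right (hF hx.2) hL.le),
        neg_nonpos.2 (div_nonneg (h0 x) hL.le)⟩)
  simpa only [integral_eq, integral_neg, integral_div, sub_neg_eq_add] using h

theorem tendsto_bChar_of_tendstoInMeasure (S : GammaProcess P) [IsProbabilityMeasure P]
    {F : ℝ → ℝ} (hF : Monotone F) (h0 : ∀ x, 0 ≤ F x) (hlim : Tendsto (cumul F) atTop atTop)
    (hR : TendstoInMeasure P (fun t ω => S.integral F t ω / cumul F t) atTop fun _ => 1) :
    Tendsto (bChar F) atTop (𝓝 0) := by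
  refine tendsto_bChar_of_increment hF h0 hlim ?_
  have hshift := tendsto_atTop_add_const_right atTop (1 : ℝ) tendsto_id
  have hlim1 := hlim.comp hshift
  refine tendsto_order.2 ⟨fun y hy => ?_, fun δ hδ => ?_⟩
  · filter_upwards [hlim1.eventually_gt_atTop 0] with t (ht : 0 < cumul F (t + 1))
    exact hy.trans_le (div_nonneg (intervalIntegral.integral_nonneg (by linarith)
      fun x _ => h0 x) ht.le)
  · have hφ : 0 < δ - Real.log (1 + δ) := by
      have := Real.log_lt_sub_one_of_pos (show 0 < 1 + δ by linarith) (by linarith)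
      linarith
    -- The same `ε` bounds both the deviation of the ratio from `1` and the probability of exceeding
    -- it, so `E exp(-R)` falls strictly below the value forced by an increment share of at least
    -- `δ`.
    obtain ⟨ε, hε, hε0⟩ : ∃ ε : ℝ, Real.exp (-1 + ε) + ε <
        Real.exp (-1 + (δ - Real.log (1 + δ))) ∧ 0 < ε := by
      have hc : Tendsto (fun ε : ℝ => Real.exp (-1 + ε) + ε) (𝓝[>] 0)
          (𝓝 (Real.exp (-1 + 0) + 0)) :=
        Tendsto.mono_left (Continuous.tendsto (by fun_prop) 0) nhdsWithin_le_nhds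
      exact ((hc.eventually_lt_const (by
        rw [add_zero]; exact Real.exp_lt_exp.2 (by linarith))).and self_mem_nhdsWithin).exists
    have hm := ((hR (ENNReal.ofReal ε) (by simpa using hε0)).comp hshift).eventually_le_const
      (show 0 < ENNReal.ofReal ε by simpa using hε0)
    filter_upwards [hm, hlim1.eventually_gt_atTop 0, eventually_ge_atTop 0] with t ht
      (hpos : 0 < cumul F (t + 1)) ht0
    by_contra! hcon
    have h1 := S.lintegral_exp_neg_ratio hF h0 (T := t + 1) (by linarith) hpos
    have h2 := lintegral_exp_neg_le P (R := fun ω => S.integral F (t + 1) ω / cumul F (t + 1))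
      ((S.measurable_integral _ hF.measurable).div_const _)
      (ae_of_all _ fun ω => div_nonneg (integral_nonneg h0) hpos.le) (ε := ε)
    rw [h1] at h2
    have h3 := h2.trans (add_le_add_right ht _)
    rw [← ENNReal.ofReal_add (Real.exp_pos _).le hε0.le,
      ENNReal.ofReal_le_ofReal_iff (by positivity)] at h3
    have h4 := integral_log_one_add_div_le hF h0 ht0 hpos
    have h5 := sub_log_one_add_mono hδ.le hcon
    have h6 : Real.exp (-1 + (δ - Real.log (1 + δ))) ≤
        Real.exp (-∫ x in Ioc 0 (t + 1), Real.log (1 + F x / cumul F (t + 1))) :=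
      Real.exp_le_exp.2 (by linarith)
    linarith

end GammaProcess

/-! ### Exponential moments and convergence in `L^p`. -/

theorem abs_pow_le_factorial_mul_exp (x : ℝ) (n : ℕ) :
    |x| ^ n ≤ n.factorial * (Real.exp x + Real.exp (-x)) := by
  have h := Real.pow_div_factorial_le_exp |x| (abs_nonneg x) n
  rw [div_le_iff₀ (by positivity), mul_comm] at h
  refine h.trans (mul_le_mul_of_nonneg_left ?_ (by positivity))
  rcases abs_choice x with hx | hx <;> rw [hx] <;> linarith [Real.exp_pos x, Real.exp_pos (-x)]

namespace GammaProcess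

variable {Ω : Type*} [MeasurableSpace Ω] {P : Measure Ω}

/-- Put `h = θ k / L` with `L = λ_T k`. Then `∫ h = θ` cancels the centring, and `∫ h² ≤ θ² M / L`
because `k² ≤ M k`; the condition on `θ` gives `|h| ≤ 1/2`, where `-log(1 - h) ≤ h + 2h²`. -/
theorem lintegral_exp_mul_ratio_sub_one_le (S : GammaProcess P) {T M θ : ℝ} (hT : 0 < T)
    {k : ℝ → ℝ} (hk : Measurable k) (hkM : ∀ᵐ x ∂volume.restrict (Ioc 0 T), k x ∈ Icc 0 M)
    (hpos : 0 < cumul k T) (hθ : |θ| * (M / cumul k T) ≤ 1 / 2) :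
    ∫⁻ ω, ENNReal.ofReal (Real.exp (θ * (S.integral k T ω / cumul k T - 1))) ∂P ≤
      ENNReal.ofReal (Real.exp (2 * θ ^ 2 * (M / cumul k T))) := by
  set L := cumul k T with hL
  rw [cumul_eq_setIntegral k hT.le] at hL
  set h : ℝ → ℝ := fun x => θ / L * k x with hh
  have hki : Integrable k (volume.restrict (Ioc 0 T)) :=
    Integrable.of_mem_Icc 0 M hk.aemeasurable hkM
  have habs : ∀ᵐ x ∂volume.restrict (Ioc 0 T), |h x| ≤ 1 / 2 := by
    filter_upwards [hkM] with x hx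
    refine le_trans ?_ hθ
    rw [hh, abs_mul, abs_div, abs_of_pos hpos, abs_of_nonneg hx.1, div_mul_eq_mul_div, mul_div_assoc]
    gcongr
    exact hx.2
  have hm : Measurable h := hk.const_mul _
  have key := S.lintegral_exp_integral_le hT (show (1 / 2 : ℝ) < 1 by norm_num) hm
    (A := -(1 / 2)) (by filter_upwards [habs] with x hx using abs_le.1 hx)
  have hlogi : Integrable (fun x => -Real.log (1 - h x)) (volume.restrict (Ioc 0 T)) := by
    refine Integrable.of_mem_Icc (-Real.log (1 - -(1 / 2))) (-Real.log (1 - 1 / 2)) (by fun_prop) ?_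
    filter_upwards [habs] with x hx
    obtain ⟨h1, h2⟩ := abs_le.1 hx
    exact ⟨neg_le_neg (Real.log_le_log (by linarith) (by linarith)),
      neg_le_neg (Real.log_le_log (by norm_num) (by linarith))⟩
  have hbound : ∫ x in Ioc 0 T, -Real.log (1 - h x) ≤ θ + 2 * θ ^ 2 * (M / L) := by
    have h1 : ∫ x in Ioc 0 T, -Real.log (1 - h x) ≤
        ∫ x in Ioc 0 T, (θ / L + 2 * (θ / L) ^ 2 * M) * k x := by
      refine integral_mono_ae hlogi (hki.const_mul _) ?_
      filter_upwards [habs, hkM] with x hx hx2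
      refine (neg_log_one_sub_le hx).trans ?_
      have : k x ^ 2 ≤ M * k x := by nlinarith [hx2.1, hx2.2]
      have := mul_le_mul_of_nonneg_left this (show 0 ≤ 2 * (θ / L) ^ 2 by positivity)
      simp only [hh]
      linarith
    refine h1.trans_eq ?_
    rw [integral_const_mul, ← hL]
    field_simp
  calc ∫⁻ ω, ENNReal.ofReal (Real.exp (θ * (S.integral k T ω / L - 1))) ∂P
      = ENNReal.ofReal (Real.exp (-θ)) *
          ∫⁻ ω, ENNReal.ofReal (Real.exp (S.integral h T ω)) ∂P := by
        rw [← lintegral_const_mul _ (S.measurable_integral T hm).exp.ennreal_ofReal]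
        refine lintegral_congr fun ω => ?_
        rw [← ENNReal.ofReal_mul (Real.exp_pos _).le, ← Real.exp_add, integral_eq, integral_eq,
          hh, integral_const_mul]
        congr 2
        field_simp
        ring
    _ ≤ ENNReal.ofReal (Real.exp (-θ)) *
          ENNReal.ofReal (Real.exp (θ + 2 * θ ^ 2 * (M / L))) := by
        gcongr
        exact key.trans (ENNReal.ofReal_le_ofReal (Real.exp_le_exp.2 hbound))
    _ = _ := by
        rw [← ENNReal.ofReal_mul (Real.exp_pos _).le, ← Real.exp_add]
        congr 2
        ring

/-- Exponential moments at `θ = K` and `θ = -K` dominate the `n`-th moment. Since `K` may be taken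
large before `T`, the factor `K ^ n` drives the moments to zero. -/
theorem lintegral_ratio_sub_one_pow_le (S : GammaProcess P) {T M K : ℝ} (hT : 0 < T) (hK : 0 < K)
    {k : ℝ → ℝ} (hk : Measurable k) (hkM : ∀ᵐ x ∂volume.restrict (Ioc 0 T), k x ∈ Icc 0 M)
    (hpos : 0 < cumul k T) (hθ : K * (M / cumul k T) ≤ 1 / 2)
    (hθ2 : 2 * K ^ 2 * (M / cumul k T) ≤ 1) (n : ℕ) :
    ∫⁻ ω, ‖S.integral k T ω / cumul k T - 1‖ₑ ^ n ∂P ≤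
      ENNReal.ofReal (n.factorial * 2 * Real.exp 1 / K ^ n) := by
  set R : Ω → ℝ := fun ω => S.integral k T ω / cumul k T - 1 with hR
  have hRm : Measurable R := ((S.measurable_integral T hk).div_const _).sub_const _
  have h1 := S.lintegral_exp_mul_ratio_sub_one_le hT hk hkM hpos (θ := K) (by rwa [abs_of_pos hK])
  have h2 := S.lintegral_exp_mul_ratio_sub_one_le hT hk hkM hpos (θ := -K)
    (by rwa [abs_neg, abs_of_pos hK])
  rw [neg_sq] at h2
  have hE : ENNReal.ofReal (Real.exp (2 * K ^ 2 * (M / cumul k T))) ≤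
      ENNReal.ofReal (Real.exp 1) := ENNReal.ofReal_le_ofReal (Real.exp_le_exp.2 hθ2)
  calc ∫⁻ ω, ‖R ω‖ₑ ^ n ∂P
      ≤ ∫⁻ ω, ENNReal.ofReal (n.factorial / K ^ n) *
          (ENNReal.ofReal (Real.exp (K * R ω)) + ENNReal.ofReal (Real.exp (-K * R ω))) ∂P := by
        refine lintegral_mono fun ω => ?_
        rw [Real.enorm_eq_ofReal_abs, ← ENNReal.ofReal_pow (abs_nonneg _),
          ← ENNReal.ofReal_add (Real.exp_pos _).le (Real.exp_pos _).le,
          ← ENNReal.ofReal_mul (by positivity)]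
        refine ENNReal.ofReal_le_ofReal ?_
        have := abs_pow_le_factorial_mul_exp (K * R ω) n
        rw [abs_mul, abs_of_pos hK, mul_pow] at this
        rw [div_mul_eq_mul_div, le_div_iff₀ (by positivity), neg_mul]
        linarith
    _ = ENNReal.ofReal (n.factorial / K ^ n) * (∫⁻ ω, ENNReal.ofReal (Real.exp (K * R ω)) ∂P +
          ∫⁻ ω, ENNReal.ofReal (Real.exp (-K * R ω)) ∂P) := by
        rw [lintegral_const_mul _ (by fun_prop), lintegral_add_left (by fun_prop)]
    _ ≤ ENNReal.ofReal (n.factorial / K ^ n) *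
          (ENNReal.ofReal (Real.exp 1) + ENNReal.ofReal (Real.exp 1)) := by
        gcongr
        · exact h1.trans hE
        · exact h2.trans hE
    _ = _ := by
        rw [← ENNReal.ofReal_add (Real.exp_pos _).le (Real.exp_pos _).le,
          ← ENNReal.ofReal_mul (by positivity)]
        congr 1
        ring

theorem tendsto_lintegral_ratio_sub_one_pow (S : GammaProcess P) {k M : ℝ → ℝ} (hk : Measurable k)
    (hkM : ∀ T, ∀ᵐ x ∂volume.restrict (Ioc 0 T), k x ∈ Icc 0 (M T))
    (hlim : Tendsto (cumul k) atTop atTop) (hM : Tendsto (fun T => M T / cumul k T) atTop (𝓝 0))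
    {n : ℕ} (hn : n ≠ 0) :
    Tendsto (fun T => ∫⁻ ω, ‖S.integral k T ω / cumul k T - 1‖ₑ ^ n ∂P) atTop (𝓝 0) := by
  rw [ENNReal.tendsto_nhds_zero]
  intro ε hε
  have hc : Tendsto (fun K : ℝ => ENNReal.ofReal (n.factorial * 2 * Real.exp 1 / K ^ n)) atTop
      (𝓝 0) := by
    rw [← ENNReal.ofReal_zero]
    exact ENNReal.tendsto_ofReal ((tendsto_pow_atTop hn).const_div_atTop _)
  obtain ⟨K, hKε, hK⟩ := ((hc.eventually_le_const hε).and (eventually_gt_atTop 0)).exists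
  filter_upwards [eventually_gt_atTop 0, hlim.eventually_gt_atTop 0,
    hM.eventually_le_const (show 0 < 1 / 2 / K by positivity),
    hM.eventually_le_const (show 0 < 1 / (2 * K ^ 2) by positivity)] with T hT hpos h1 h2
  refine (S.lintegral_ratio_sub_one_pow_le hT hK hk (hkM T) hpos ?_ ?_ n).trans hKε
  · rwa [le_div_iff₀ hK, mul_comm] at h1
  · rwa [le_div_iff₀ (by positivity), mul_comm] at h2

theorem tendsto_eLpNorm_ratio_sub_one (S : GammaProcess P) [IsProbabilityMeasure P] {k M : ℝ → ℝ}
    (hk : Measurable k) (hkM : ∀ T, ∀ᵐ x ∂volume.restrict (Ioc 0 T), k x ∈ Icc 0 (M T))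
    (hlim : Tendsto (cumul k) atTop atTop) (hM : Tendsto (fun T => M T / cumul k T) atTop (𝓝 0))
    (p : ℝ≥0) :
    Tendsto (fun T => eLpNorm (fun ω => S.integral k T ω / cumul k T - 1) p P) atTop (𝓝 0) := by
  obtain ⟨n, hpn⟩ := exists_nat_ge p
  have h := S.tendsto_lintegral_ratio_sub_one_pow hk hkM hlim hM n.succ_ne_zero
  have h' := (ENNReal.continuous_rpow_const (y := 1 / ((n.succ : ℕ) : ℝ))).tendsto 0 |>.comp h
  rw [ENNReal.zero_rpow_of_pos (by positivity)] at h'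
  refine tendsto_of_tendsto_of_tendsto_of_le_of_le tendsto_const_nhds h' (fun _ => zero_le)
    fun T => ?_
  have hle : (p : ℝ≥0∞) ≤ (n.succ : ℕ) := by
    have : (p : ℝ≥0∞) ≤ ((n.succ : ℕ) : ℝ≥0) :=
      ENNReal.coe_le_coe.2 (hpn.trans (by exact_mod_cast n.le_succ))
    simpa using this
  refine (eLpNorm_le_eLpNorm_of_exponent_le hle
    (((S.measurable_integral T hk).div_const _).sub_const _).aestronglyMeasurable).trans_eq ?_
  rw [eLpNorm_eq_lintegral_rpow_enorm_toReal (by simp) (by simp)]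
  simp only [ENNReal.toReal_natCast, ENNReal.rpow_natCast, Function.comp]

theorem convergesInLp_ratio (S : GammaProcess P) [IsProbabilityMeasure P] {k M : ℝ → ℝ}
    (hk : Measurable k) (hkM : ∀ T, ∀ᵐ x ∂volume.restrict (Ioc 0 T), k x ∈ Icc 0 (M T))
    (hlim : Tendsto (cumul k) atTop atTop) (hM : Tendsto (fun T => M T / cumul k T) atTop (𝓝 0))
    (p : ℝ≥0) : ConvergesInLp P p (fun t ω => S.integral k t ω / cumul k t) 1 := by
  have hm : ∀ t, Measurable fun ω => S.integral k t ω / cumul k t := fun t =>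
    (S.measurable_integral t hk).div_const _
  refine ⟨?_, ?_⟩
  · filter_upwards [(S.tendsto_eLpNorm_ratio_sub_one hk hkM hlim hM p).eventually_lt_const
      ENNReal.zero_lt_top] with t ht
    have h1 : MemLp (fun ω => S.integral k t ω / cumul k t - 1) p P :=
      ⟨((hm t).sub_const 1).aestronglyMeasurable, ht⟩
    simpa [Pi.add_def] using h1.add (memLp_const (1 : ℝ))
  · split_ifs
    -- At exponent `0` the seminorm is identically zero and carries no information, so convergence
    -- in probability is taken from `L¹`.
    · exact tendstoInMeasure_of_tendsto_eLpNorm one_ne_zero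
        (fun t => (hm t).aestronglyMeasurable) aestronglyMeasurable_const
        (by simpa [Pi.sub_def] using S.tendsto_eLpNorm_ratio_sub_one hk hkM hlim hM 1)
    · exact S.tendsto_eLpNorm_ratio_sub_one hk hkM hlim hM p

end GammaProcess

/-! ### Passage to an extension on the whole line, and conclusion. -/

theorem cumul_congr {f F : ℝ → ℝ} (h : EqOn f F (Ici 0)) {t : ℝ} (ht : 0 ≤ t) :
    cumul f t = cumul F t := by
  rw [cumul_eq_setIntegral f ht, cumul_eq_setIntegral F ht]
  exact setIntegral_congr_fun measurableSet_Ioc fun x hx => h hx.1.le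

theorem cumul_eventuallyEq {f F : ℝ → ℝ} (h : EqOn f F (Ici 0)) : cumul f =ᶠ[atTop] cumul F := by
  filter_upwards [eventually_ge_atTop 0] with t ht using cumul_congr h ht

theorem vChar_eventuallyEq {f F : ℝ → ℝ} (h : EqOn f F (Ici 0)) : vChar f =ᶠ[atTop] vChar F := by
  filter_upwards [eventually_ge_atTop 0] with t ht
  rw [vChar, vChar, cumul_congr h ht, cumul_congr (F := fun x => F x ^ 2) _ ht]
  exact fun x hx => by simp only [h hx]

theorem bChar_eventuallyEq {f F : ℝ → ℝ} (h : EqOn f F (Ici 0)) : bChar f =ᶠ[atTop] bChar F := by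
  filter_upwards [eventually_ge_atTop 0] with t ht
  rw [bChar, bChar, cumul_congr h ht, h ht]

theorem GammaProcess.integral_congr {Ω : Type*} [MeasurableSpace Ω] {P : Measure Ω}
    (S : GammaProcess P) {f F : ℝ → ℝ} (h : EqOn f F (Ici 0)) (t : ℝ) :
    S.integral f t = S.integral F t :=
  funext fun _ => setIntegral_congr_fun measurableSet_Ioc fun _ hx => h hx.1.le

theorem ConvergesInLp.congr {Ω : Type*} [MeasurableSpace Ω] {P : Measure Ω} {p : ℝ≥0}
    {R R' : ℝ → Ω → ℝ} {c : ℝ} (hR : ConvergesInLp P p R c) (h : R =ᶠ[atTop] R') :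
    ConvergesInLp P p R' c := by
  refine ⟨?_, ?_⟩
  · filter_upwards [hR.1, h] with t ht he using he ▸ ht
  · have h2 := hR.2
    split_ifs at h2 ⊢
    · intro ε hε
      refine (h2 ε hε).congr' ?_
      filter_upwards [h] with t he
      rw [he]
    · refine h2.congr' ?_
      filter_upwards [h] with t he
      rw [he]

theorem GammaProcess.ratio_eventuallyEq {Ω : Type*} [MeasurableSpace Ω] {P : Measure Ω}
    (S : GammaProcess P) {f F : ℝ → ℝ} (h : EqOn f F (Ici 0)) :
    (fun t ω => S.integral f t ω / cumul f t) =ᶠ[atTop]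
      fun t ω => S.integral F t ω / cumul F t := by
  filter_upwards [eventually_ge_atTop 0] with t ht
  rw [S.integral_congr h, cumul_congr h ht]

theorem tendsto_cumul_and_bChar {f F : ℝ → ℝ} (hF : Monotone F) (h0 : ∀ x, 0 ≤ F x)
    (h : EqOn f F (Ici 0)) (hf : InClassOD.{u} f ∨ InClassV f ∨ InClassB f) :
    Tendsto (cumul F) atTop atTop ∧ Tendsto (bChar F) atTop (𝓝 0) := by
  rcases hf with ⟨Ω, _, P, _, S, -, hlim, hR⟩ | ⟨-, hlim, hv⟩ | ⟨-, hlim, hb⟩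
  · have hlim' := hlim.congr' (cumul_eventuallyEq h)
    have hm := (hR.congr (S.ratio_eventuallyEq h)).2
    rw [if_pos rfl] at hm
    exact ⟨hlim', S.tendsto_bChar_of_tendstoInMeasure hF h0 hlim' hm⟩
  · have hlim' := hlim.congr' (cumul_eventuallyEq h)
    exact ⟨hlim', tendsto_bChar_of_tendsto_vChar hF h0 hlim' (hv.congr' (vChar_eventuallyEq h))⟩
  · exact ⟨hlim.congr' (cumul_eventuallyEq h), hb.congr' (bChar_eventuallyEq h)⟩

theorem IsRegularPeriodicFactor.mul_mem_Icc {g : ℝ → ℝ} (hg : IsRegularPeriodicFactor g)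
    {F : ℝ → ℝ} (hF : Monotone F) (h0 : ∀ x, 0 ≤ F x) (t : ℝ) :
    ∀ᵐ x ∂volume.restrict (Ioc 0 t), F x * g x ∈ Icc 0 (F t) := by
  filter_upwards [ae_restrict_mem measurableSet_Ioc, ae_restrict_of_ae hg.ae_le_one] with x hx hx1
  exact ⟨mul_nonneg (h0 x) (hg.nonneg x), (mul_le_of_le_one_right (h0 x) hx1).trans (hF hx.2)⟩

theorem mainTheorem6 (g : ℝ → ℝ) (hg : IsRegularPeriodicFactor g) :
    ∃ C : ℝ, 0 < C ∧ ∀ f : ℝ → ℝ, (∀ x, 0 ≤ x → 0 ≤ f x) → MonotoneOn f (Set.Ici 0) →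
      (InClassOD.{u} f ∨ InClassV f ∨ InClassB f) →
        (∀ t, MemLp (fun x => f x * g x) 2 (volume.restrict (Set.Ioc 0 t))) ∧
        (∀ᶠ t in atTop, vChar (fun x => f x * g x) t ≤ C * vChar f t) ∧
        ∀ (Ω : Type v) [MeasurableSpace Ω] (P : Measure Ω) [IsProbabilityMeasure P]
          (S : GammaProcess P) (p : ℝ≥0), OrderlyDivergent S p (fun x => f x * g x) := by
  obtain ⟨c, hc, hcg⟩ := hg.exists_cumul_mul_ge
  refine ⟨1 / c ^ 2, by positivity, fun f hf0 hfm hf => ?_⟩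
  -- The values of `f` at negative arguments are arbitrary. The extension by `f 0` is monotone and
  -- nonnegative on the whole line, hence measurable and interval integrable, and agrees with `f`
  -- wherever the integrals are taken.
  set F : ℝ → ℝ := fun x => f (max x 0) with hFdef
  have hF : Monotone F := fun x y hxy =>
    hfm (le_max_right x 0) (le_max_right y 0) (max_le_max_right 0 hxy)
  have h0 : ∀ x, 0 ≤ F x := fun x => hf0 _ (le_max_right x 0)
  have hfF : EqOn f F (Ici 0) := fun x (hx : 0 ≤ x) => by simp only [hFdef, max_eq_left hx]
  have hfg : EqOn (fun x => f x * g x) (fun x => F x * g x) (Ici 0) := fun x hx => by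
    simp only [hfF hx]
  obtain ⟨hlim, hb⟩ := tendsto_cumul_and_bChar hF h0 hfF hf
  have hge := hcg F hF h0 hlim hb
  have hk : Measurable fun x => F x * g x := hF.measurable.mul hg.measurable
  have hkM := hg.mul_mem_Icc hF h0
  have hklim : Tendsto (cumul fun x => F x * g x) atTop atTop :=
    tendsto_atTop_mono' _ hge (hlim.const_mul_atTop hc)
  -- The ratio is eventually at most `b_t(F) / c`. The bound `F t`, not `F t * g t`, is what
  -- dominates the product on all of `(0, t]`.
  have hM : Tendsto (fun t => F t / cumul (fun x => F x * g x) t) atTop (𝓝 0) := by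
    have hb' := hb.div_const c
    rw [zero_div] at hb'
    refine squeeze_zero' ?_ ?_ hb'
    · filter_upwards [hklim.eventually_gt_atTop 0] with t ht using div_nonneg (h0 t) ht.le
    · filter_upwards [hge, hlim.eventually_gt_atTop 0] with t ht hpos
      rw [bChar, div_div, mul_comm _ c]
      exact div_le_div_of_nonneg_left (h0 t) (by positivity) ht
  have hmem : ∀ t (q : ℝ≥0∞), MemLp (fun x => f x * g x) q (volume.restrict (Ioc 0 t)) := by
    intro t q
    refine (memLp_congr_ae ?_).2 (memLp_of_bounded (hkM t) hk.aestronglyMeasurable q)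
    filter_upwards [ae_restrict_mem measurableSet_Ioc] with x hx using hfg hx.1.le
  refine ⟨fun t => hmem t 2, ?_, fun Ω _ P _ S p => ⟨fun t => ?_, ?_, ?_⟩⟩
  · filter_upwards [vChar_eventuallyEq hfg, vChar_eventuallyEq hfF, hge,
      hlim.eventually_gt_atTop 0, eventually_ge_atTop 0] with t h1 h2 h3 h4 h5
    rw [h1, h2]
    exact hg.vChar_mul_le hF h0 hc h5 h4 h3
  · exact memLp_one_iff_integrable.1 (hmem t 1)
  · exact hklim.congr' (cumul_eventuallyEq hfg).symm
  · exact (S.convergesInLp_ratio hk hkM hklim hM p).congr (S.ratio_eventuallyEq hfg).symm
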